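/- Let $H$ be a complex Hilbert space, $m\ge 1$, $C_1,\dots,C_m\in B(H)$ contractions, and let $R_0\in S_1(H)_+$ be a positive trace-class operator. Equip $S_1(H)_+$ with the trace-norm topology and its Borel $\sigma$-field. For finite words $w$ over $\{1,\dots,m\}$ put $R_\emptyset:=R_0$, $R_{wj}:=R_w^{1/2}(I-C_j^*C_j)R_w^{1/2}$, $D_{w,j}:=R_w-R_{wj}=R_w^{1/2}C_j^*C_jR_w^{1/2}$ and $s_w:=\sum_{j=1}^m\operatorname{tr}(D_{w,j})$. Let $\mathcal A=\{0,1,\dots,m\}$ and $\Omega=\mathcal A^{\mathbb N}$ with the product topology. For a finite word $u$ over $\mathcal A$ define transition probabilities as follows: if $u$ contains no $0$ and $s_u>0$, then $p_{u,0}=0$ and $p_{u,j}=\operatorname{tr}(D_{u,j})/s_u$ for $1\le j\le m$; otherwise $p_{u,0}=1$ and $p_{u,j}=0$ for $1\le j\le m$. Let $\nu_{\mathrm{tr}}$ be the unique Borel probability measure on $\Omega$ whose values on the cylinders $[u]=\{\omega:\omega_1\cdots\omega_{|u|}=u\}$ satisfy $\nu_{\mathrm{tr}}([\emptyset])=1$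 and $\nu_{\mathrm{tr}}([ua])=\nu_{\mathrm{tr}}([u])\,p_{u,a}$ for $a\in\mathcal A$. For $\omega\in\Omega$ let $R_n(\omega):=R_v$, where $v$ is the maximal prefix of $\omega_1\cdots\omega_n$ that contains no $0$. The sequence $R_n(\omega)$ is decreasing; let $R_\infty(\omega)\in S_1(H)_+$ be its limit in the strong operator topology. Then $R_\infty:\Omega\to S_1(H)_+$ is Borel measurable. Let $\mu_{\mathrm{tr}}:=(R_\infty)_\#\nu_{\mathrm{tr}}$ and $\mathcal B_{\mathrm{WR}}:=\sigma(R_\infty)$. There exists a Borel kernel $T\mapsto\nu_{\mathrm{tr}}^T$ from $S_1(H)_+$ into probability measures on $\Omega$ such that: 1. For every Borel set $E\subset\Omega$, the map $T\mapsto\nu_{\mathrm{tr}}^T(E)$ is Borel, and $$\nu_{\mathrm{tr}}(E)=\int_{S_1(H)_+}\nu_{\mathrm{tr}}^T(E)\,d\mu_{\mathrm{tr}}(T).$$ 2. For $\mu_{\mathrm{tr}}$-almost every $T$, $\nu_{\mathrm{tr}}^T(\{\omega:R_\infty(\omega)=T\})=1$. 3. For every (real- or complex-valued) $f\in L^1(\nu_{\mathrm{tr}})$,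 for $\nu_{\mathrm{tr}}$-almost every $\omega$ the function $f$ is integrable with respect to $\nu_{\mathrm{tr}}^{R_\infty(\omega)}$ and $$\mathbb E_{\nu_{\mathrm{tr}}}[f\mid\mathcal B_{\mathrm{WR}}](\omega)=\int_\Omega f(\eta)\,d\nu_{\mathrm{tr}}^{R_\infty(\omega)}(\eta).$$ -/

import Mathlib

set_option linter.unusedSectionVars false

open MeasureTheory ProbabilityTheory Filter Topology
open scoped ENNReal
namespace WRTree
noncomputable section
section Trace

variable {H : Type*} [NormedAddCommGroup H] [InnerProductSpace ℂ H] [CompleteSpace H]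

/-- The vectors of a chosen orthonormal basis of `H`. -/
def basisSet (H : Type*) [NormedAddCommGroup H] [InnerProductSpace ℂ H] [CompleteSpace H] :
    Set H :=
  (exists_hilbertBasis ℂ H).choose

/-- A chosen orthonormal (Hilbert) basis of `H`. -/
def basis (H : Type*) [NormedAddCommGroup H] [InnerProductSpace ℂ H] [CompleteSpace H] :
    HilbertBasis (basisSet H) ℂ H :=
  (exists_hilbertBasis ℂ H).choose_spec.choose

/-- The trace `∑ ⟨e_i, A e_i⟩ ∈ [0, ∞]` of a positive operator `A`. It does not depend on the
orthonormal basis, see `posTrace_eq_tsum`. -/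
def posTrace (A : H →L[ℂ] H) : ℝ≥0∞ :=
  ∑' i, ENNReal.ofReal (inner ℂ (basis H i) (A (basis H i))).re

/-- The trace norm `‖A‖₁ = tr |A|`, where `|A| = (A* A)^{1/2}`. -/
def traceNorm (A : H →L[ℂ] H) : ℝ≥0∞ := posTrace (CFC.abs A)

lemma tsum_sq {ι : Type*} (b : HilbertBasis ι ℂ H) (x : H) :
    ∑' i, ENNReal.ofReal (‖inner ℂ (b i) x‖ ^ 2) = ENNReal.ofReal (‖x‖ ^ 2) := by
  have h := b.hasSum_inner_mul_inner x x
  have h2 : HasSum (fun i => ‖inner ℂ (b i) x‖ ^ 2) (‖x‖ ^ 2) := by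
    have h3 := Complex.hasSum_re h
    have e : (inner ℂ x x).re = ‖x‖ ^ 2 := inner_self_eq_norm_sq (𝕜 := ℂ) x
    rw [e] at h3
    convert! h3 using 2 with i
    refine Eq.trans ?_ (inner_mul_symm_re_eq_norm (𝕜 := ℂ) x (b i)).symm
    rw [norm_mul, norm_inner_symm x, sq]
  rw [← h2.tsum_eq, ENNReal.ofReal_tsum_of_nonneg (fun _ => by positivity) h2.summable]

lemma tsum_norm_sq_star {ι κ : Type*} (b : HilbertBasis ι ℂ H) (c : HilbertBasis κ ℂ H)
    (X : H →L[ℂ] H) :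
    ∑' i, ENNReal.ofReal (‖X (b i)‖ ^ 2) = ∑' j, ENNReal.ofReal (‖(star X) (c j)‖ ^ 2) := by
  simp_rw [← tsum_sq c (X _), ← tsum_sq b ((star X) _)]
  rw [ENNReal.tsum_comm]
  congr! 5 with j i
  rw [ContinuousLinearMap.star_eq_adjoint, ContinuousLinearMap.adjoint_inner_right,
    norm_inner_symm]

lemma re_inner_star_mul_self (X : H →L[ℂ] H) (x : H) :
    (inner ℂ x ((star X * X) x)).re = ‖X x‖ ^ 2 := by
  rw [ContinuousLinearMap.star_eq_adjoint, mul_apply_eq_comp,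
    ContinuousLinearMap.adjoint_inner_right]
  exact inner_self_eq_norm_sq (𝕜 := ℂ) _

lemma star_sqrt_mul_sqrt {A : H →L[ℂ] H} (hA : 0 ≤ A) : star (CFC.sqrt A) * CFC.sqrt A = A := by
  rw [(CFC.sqrt_nonneg A).isSelfAdjoint.star_eq, CFC.sqrt_mul_sqrt_self A]

lemma re_inner_eq_sqrt {A : H →L[ℂ] H} (hA : 0 ≤ A) (x : H) :
    (inner ℂ x (A x)).re = ‖CFC.sqrt A x‖ ^ 2 := by
  conv_lhs => rw [← star_sqrt_mul_sqrt hA]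
  exact re_inner_star_mul_self _ _

/-- The trace of a positive operator may be computed in any orthonormal basis. -/
lemma posTrace_eq_tsum {ι : Type*} (b : HilbertBasis ι ℂ H) {A : H →L[ℂ] H} (hA : 0 ≤ A) :
    posTrace A = ∑' i, ENNReal.ofReal (inner ℂ (b i) (A (b i))).re := by
  simp_rw [posTrace, re_inner_eq_sqrt hA]
  rw [tsum_norm_sq_star (basis H) (basis H), ← tsum_norm_sq_star b (basis H)]

lemma posTrace_mono {A B : H →L[ℂ] H} (h : A ≤ B) : posTrace A ≤ posTrace B := by
  refine ENNReal.tsum_le_tsum fun i => ENNReal.ofReal_le_ofReal ?_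
  have := ((ContinuousLinearMap.le_def A B).1 h).re_inner_nonneg_right (basis H i)
  simpa [inner_sub_right] using this

lemma posTrace_add {A B : H →L[ℂ] H} (hA : 0 ≤ A) (hB : 0 ≤ B) :
    posTrace (A + B) = posTrace A + posTrace B := by
  rw [posTrace, posTrace, posTrace, ← ENNReal.tsum_add]
  congr! 2 with i
  rw [add_apply, inner_add_right, Complex.add_re, ENNReal.ofReal_add]
  · rw [re_inner_eq_sqrt hA]; positivity
  · rw [re_inner_eq_sqrt hB]; positivity

lemma posTrace_conj_le {P E : H →L[ℂ] H} (hP : 0 ≤ P) (hE : ‖E‖ ≤ 1) :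
    posTrace (star E * P * E) ≤ posTrace P := by
  have e : star E * P * E = star (CFC.sqrt P * E) * (CFC.sqrt P * E) := by
    rw [star_mul]
    conv_lhs => rw [← star_sqrt_mul_sqrt hP]
    simp only [mul_assoc]
  rw [e]
  simp_rw [posTrace, re_inner_star_mul_self, re_inner_eq_sqrt hP]
  rw [tsum_norm_sq_star (basis H) (basis H), star_mul,
    (CFC.sqrt_nonneg P).isSelfAdjoint.star_eq]
  refine ENNReal.tsum_le_tsum fun i => ENNReal.ofReal_le_ofReal ?_
  gcongr
  rw [mul_apply_eq_comp]
  exact ((star E).le_of_opNorm_le (by rwa [norm_star]) _).trans_eq (one_mul _)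

lemma posTrace_posPart_le {A P : H →L[ℂ] H} (hA : IsSelfAdjoint A) (hP : 0 ≤ P) (hAP : A ≤ P) :
    posTrace A⁺ ≤ posTrace P := by
  let K := (LinearMap.range (A⁺ : H →L[ℂ] H).toLinearMap).topologicalClosure
  have : CompleteSpace K := (Submodule.isClosed_topologicalClosure _).completeSpace_coe
  let E : H →L[ℂ] H := K.starProjection
  have hE : star E = E := (isSelfAdjoint_starProjection K).star_eq
  have hEn : ‖E‖ ≤ 1 := Submodule.starProjection_norm_le K
  have hp : star A⁺ = A⁺ := (CFC.posPart_nonneg A).isSelfAdjoint.star_eq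
  have h1 : E * A⁺ = A⁺ := by
    ext x
    rw [mul_apply_eq_comp]
    exact Submodule.starProjection_eq_self_iff.2
      (Submodule.le_topologicalClosure _ (LinearMap.mem_range_self _ x))
  have h2 : A⁺ * E = A⁺ := by
    have := congrArg star h1
    rwa [star_mul, hE, hp] at this
  have h3 : A⁻ * E = 0 := by
    ext x
    have hx : E x ∈ K := Submodule.starProjection_apply_mem K x
    have hK : K ≤ LinearMap.ker (A⁻ : H →L[ℂ] H).toLinearMap := by
      refine Submodule.topologicalClosure_minimal _ ?_ (ContinuousLinearMap.isClosed_ker A⁻)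
      rintro _ ⟨y, rfl⟩
      have := congrArg (fun T : H →L[ℂ] H => T y) (CFC.negPart_mul_posPart A)
      exact this
    exact hK hx
  have h4 : star E * A * E = A⁺ := by
    conv_lhs => rw [← CFC.posPart_sub_negPart A hA]
    rw [mul_assoc, sub_mul, h2, h3, sub_zero, hE, h1]
  rw [← h4]
  exact (posTrace_mono (star_left_conjugate_le_conjugate hAP E)).trans (posTrace_conj_le hP hEn)

lemma traceNorm_eq_posPart_add_negPart {A : H →L[ℂ] H} (hA : IsSelfAdjoint A) :
    traceNorm A = posTrace A⁺ + posTrace A⁻ := by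
  rw [traceNorm, ← CFC.posPart_add_negPart A hA,
    posTrace_add (CFC.posPart_nonneg A) (CFC.negPart_nonneg A)]

lemma traceNorm_le_of_eq_sub {A P Q : H →L[ℂ] H} (hA : IsSelfAdjoint A) (hP : 0 ≤ P)
    (hQ : 0 ≤ Q) (h : A = P - Q) : traceNorm A ≤ posTrace P + posTrace Q := by
  have h1 : A ≤ P := by rw [h]; exact sub_le_self P hQ
  have h2 : -A ≤ Q := by rw [h, neg_sub]; exact sub_le_self Q hP
  have h3 := posTrace_posPart_le hA.neg hQ h2
  rw [CFC.posPart_neg] at h3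
  rw [traceNorm_eq_posPart_add_negPart hA]
  exact add_le_add (posTrace_posPart_le hA hP h1) h3

/-- Triangle inequality for the trace norm of self-adjoint operators. -/
lemma traceNorm_add_le {A B : H →L[ℂ] H} (hA : IsSelfAdjoint A) (hB : IsSelfAdjoint B) :
    traceNorm (A + B) ≤ traceNorm A + traceNorm B := by
  have pA := CFC.posPart_nonneg A
  have pB := CFC.posPart_nonneg B
  have nA := CFC.negPart_nonneg A
  have nB := CFC.negPart_nonneg B
  have e : A + B = (A⁺ + B⁺) - (A⁻ + B⁻) := by
    rw [add_sub_add_comm, CFC.posPart_sub_negPart A hA, CFC.posPart_sub_negPart B hB]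
  have h := traceNorm_le_of_eq_sub (hA.add hB) (add_nonneg pA pB) (add_nonneg nA nB) e
  rw [posTrace_add pA pB, posTrace_add nA nB, add_add_add_comm] at h
  rwa [traceNorm_eq_posPart_add_negPart hA, traceNorm_eq_posPart_add_negPart hB]

lemma traceNorm_of_nonneg {A : H →L[ℂ] H} (hA : 0 ≤ A) : traceNorm A = posTrace A := by
  rw [traceNorm, CFC.abs_of_nonneg A hA]

lemma eq_zero_of_traceNorm_eq_zero {A : H →L[ℂ] H} (h : traceNorm A = 0) : A = 0 := by
  rw [← CFC.abs_eq_zero_iff]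
  have h0 := CFC.abs_nonneg A
  have hS : CFC.sqrt (CFC.abs A) = 0 := by
    refine ContinuousLinearMap.ext_on
      (Submodule.dense_iff_topologicalClosure_eq_top.2 (basis H).dense_span) ?_
    rintro _ ⟨i, rfl⟩
    have := ENNReal.tsum_eq_zero.1 h i
    rw [re_inner_eq_sqrt h0, ENNReal.ofReal_eq_zero] at this
    have h2 : ‖CFC.sqrt (CFC.abs A) (basis H i)‖ = 0 := by
      have := sq_nonneg ‖CFC.sqrt (CFC.abs A) (basis H i)‖
      exact pow_eq_zero_iff two_ne_zero |>.1 (by linarith)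
    simpa using h2
  rw [← star_sqrt_mul_sqrt h0, hS, mul_zero]

/-- A decreasing sequence of positive operators converges strongly to a positive operator. -/
lemma exists_strong_limit (A : ℕ → H →L[ℂ] H) (h0 : ∀ n, 0 ≤ A n) (hA : Antitone A) :
    ∃ L : H →L[ℂ] H, (∀ x, Tendsto (fun n => A n x) atTop (𝓝 (L x))) ∧ 0 ≤ L ∧ L ≤ A 0 := by
  have key : ∀ P : H →L[ℂ] H, 0 ≤ P → ∀ x, ‖P x‖ ^ 2 ≤ ‖P‖ * (inner ℂ x (P x)).re := by
    intro P hP x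
    rw [re_inner_eq_sqrt hP]
    have e : ‖P‖ = ‖CFC.sqrt P‖ ^ 2 := by
      conv_lhs => rw [← star_sqrt_mul_sqrt hP]
      rw [CStarRing.norm_star_mul_self, sq]
    have e2 : P x = CFC.sqrt P (CFC.sqrt P x) := by
      conv_lhs => rw [← CFC.sqrt_mul_sqrt_self P]
      rfl
    rw [e, e2, ← mul_pow]
    gcongr
    exact (CFC.sqrt P).le_opNorm _
  have hq : ∀ x, Antitone fun n => (inner ℂ x (A n x)).re := fun x m n hmn => by
    have := ((ContinuousLinearMap.le_def _ _).1 (hA hmn)).re_inner_nonneg_right x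
    simpa [inner_sub_right] using this
  have hq0 : ∀ x n, 0 ≤ (inner ℂ x (A n x)).re := fun x n => by
    rw [re_inner_eq_sqrt (h0 n)]; positivity
  have hc : ∀ x, ∃ y, Tendsto (fun n => A n x) atTop (𝓝 y) := by
    intro x
    refine cauchySeq_tendsto_of_complete ?_
    have hlim := tendsto_atTop_ciInf (hq x) ⟨0, by rintro _ ⟨n, rfl⟩; exact hq0 x n⟩
    set l := ⨅ n, (inner ℂ x (A n x)).re
    refine cauchySeq_of_le_tendsto_0
      (fun n => 2 * Real.sqrt (‖A 0‖ * ((inner ℂ x (A n x)).re - l))) ?_ ?_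
    · have hb : ∀ N n, N ≤ n →
          ‖A N x - A n x‖ ≤ Real.sqrt (‖A 0‖ * ((inner ℂ x (A N x)).re - l)) := by
        intro N n hn
        refine Real.le_sqrt_of_sq_le ?_
        have hd : 0 ≤ A N - A n := sub_nonneg.2 (hA hn)
        refine (key _ hd x).trans ?_
        have h1 : ‖A N - A n‖ ≤ ‖A 0‖ :=
          CStarAlgebra.norm_le_norm_of_nonneg_of_le hd
            ((sub_le_self _ (h0 n)).trans (hA (Nat.zero_le _)))
        have h2 : l ≤ (inner ℂ x (A n x)).re := (hq x).le_of_tendsto hlim n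
        have h3 : (inner ℂ x ((A N - A n) x)).re
            = (inner ℂ x (A N x)).re - (inner ℂ x (A n x)).re := by
          simp
        have h4 := hq x hn
        rw [h3]
        exact mul_le_mul h1 (by linarith) (by simpa using h4) (norm_nonneg _)
      intro n m N hn hm
      rw [dist_eq_norm]
      have e : A n x - A m x = -(A N x - A n x) + (A N x - A m x) := by abel
      rw [e]
      refine (norm_add_le _ _).trans ?_
      rw [norm_neg]
      linarith [hb N n hn, hb N m hm]
    · have : Tendsto (fun n => 2 * Real.sqrt (‖A 0‖ * ((inner ℂ x (A n x)).re - l))) atTop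
          (𝓝 (2 * Real.sqrt (‖A 0‖ * (l - l)))) :=
        ((Real.continuous_sqrt.tendsto _).comp ((hlim.sub_const l).const_mul _)).const_mul _
      simpa using this
  choose f hf using hc
  have hT : Tendsto (fun n x => A n x) atTop (𝓝 f) := tendsto_pi_nhds.2 hf
  let L := continuousLinearMapOfTendsto A hT
  have hL : ∀ x, Tendsto (fun n => A n x) atTop (𝓝 (L x)) := hf
  have hpos : ∀ B : ℕ → H →L[ℂ] H, ∀ M : H →L[ℂ] H, (∀ n, 0 ≤ B n) →
      (∀ x, Tendsto (fun n => B n x) atTop (𝓝 (M x))) → 0 ≤ M := by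
    intro B M hB hM
    rw [ContinuousLinearMap.nonneg_iff_isPositive, ContinuousLinearMap.isPositive_iff_complex]
    intro x
    have hB' := fun n => (ContinuousLinearMap.isPositive_iff_complex (B n)).1
      ((ContinuousLinearMap.nonneg_iff_isPositive _).1 (hB n)) x
    have hi : Tendsto (fun n => inner ℂ (B n x) x) atTop (𝓝 (inner ℂ (M x) x)) :=
      (hM x).inner tendsto_const_nhds
    have hr : Tendsto (fun n => (inner ℂ (B n x) x).re) atTop (𝓝 (inner ℂ (M x) x).re) :=
      (Complex.continuous_re.tendsto _).comp hi
    refine ⟨?_, ge_of_tendsto' hr fun n => (hB' n).2⟩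
    refine tendsto_nhds_unique ((Complex.continuous_ofReal.tendsto _).comp hr) ?_
    exact hi.congr fun n => (hB' n).1.symm
  refine ⟨L, hL, hpos A L h0 hL, ?_⟩
  rw [← sub_nonneg]
  exact hpos (fun n => A 0 - A n) _ (fun n => sub_nonneg.2 (hA (Nat.zero_le n)))
    fun x => by simpa using (hL x).const_sub (A 0 x)

/-- Membership in `S₁(H)`. -/
def IsTraceClass (T : H →L[ℂ] H) : Prop := traceNorm T < ∞

lemma IsTraceClass.posTrace_ne_top {A : H →L[ℂ] H} (h : IsTraceClass A) (hA : 0 ≤ A) :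
    posTrace A ≠ ∞ := by
  rw [← traceNorm_of_nonneg hA]; exact h.ne

lemma IsTraceClass.of_le {A B : H →L[ℂ] H} (h : IsTraceClass B) (hA : 0 ≤ A) (hAB : A ≤ B) :
    IsTraceClass A := by
  rw [IsTraceClass, traceNorm_of_nonneg hA]
  exact (posTrace_mono hAB).trans_lt (h.posTrace_ne_top (hA.trans hAB)).lt_top

end Trace

/-- The cone `S₁(H)₊` of positive trace-class operators (positivity is the Loewner order). -/
structure PosTraceClass (H : Type*) [NormedAddCommGroup H] [InnerProductSpace ℂ H]
    [CompleteSpace H] where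
  op : H →L[ℂ] H
  nonneg : 0 ≤ op
  traceClass : IsTraceClass op

section Tree

variable {H : Type*} [NormedAddCommGroup H] [InnerProductSpace ℂ H] [CompleteSpace H]

lemma PosTraceClass.traceNorm_sub_ne_top (S T : PosTraceClass H) :
    traceNorm (S.op - T.op) ≠ ∞ :=
  ne_top_of_le_ne_top
    (ENNReal.add_ne_top.2 ⟨S.traceClass.posTrace_ne_top S.nonneg,
      T.traceClass.posTrace_ne_top T.nonneg⟩)
    (traceNorm_le_of_eq_sub (S.nonneg.isSelfAdjoint.sub T.nonneg.isSelfAdjoint)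
      S.nonneg T.nonneg rfl)

/-- The metric `‖S - T‖₁` of the trace norm. -/
instance : MetricSpace (PosTraceClass H) where
  dist S T := (traceNorm (S.op - T.op)).toReal
  dist_self T := by simp [traceNorm, posTrace]
  dist_comm S T := by
    rw [traceNorm, traceNorm, ← CFC.abs_neg, neg_sub]
  dist_triangle S T U := by
    rw [← ENNReal.toReal_add (S.traceNorm_sub_ne_top T) (T.traceNorm_sub_ne_top U)]
    refine ENNReal.toReal_mono (ENNReal.add_ne_top.2
      ⟨S.traceNorm_sub_ne_top T, T.traceNorm_sub_ne_top U⟩) ?_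
    rw [← sub_add_sub_cancel S.op T.op U.op]
    exact traceNorm_add_le (S.nonneg.isSelfAdjoint.sub T.nonneg.isSelfAdjoint)
      (T.nonneg.isSelfAdjoint.sub U.nonneg.isSelfAdjoint)
  eq_of_dist_eq_zero {S T} h := by
    have h1 := ((ENNReal.toReal_eq_zero_iff _).1 h).resolve_right (S.traceNorm_sub_ne_top T)
    have h2 := sub_eq_zero.1 (eq_zero_of_traceNorm_eq_zero h1)
    cases S; cases T; cases h2; rfl

instance : MeasurableSpace (PosTraceClass H) := borel _

instance : BorelSpace (PosTraceClass H) := ⟨rfl⟩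

/-- `Φ(R) = R^{1/2} (I - C* C) R^{1/2}`. -/
def residualUpdate (C R : H →L[ℂ] H) : H →L[ℂ] H :=
  CFC.sqrt R * (1 - star C * C) * CFC.sqrt R

variable {m : ℕ}

/-- The residual `R_w` at a word `w` over `{1, …, m}` (indexed here by `Fin m`):
`R_∅ = R₀` and `R_{wj} = Φ_j(R_w)`, see `residual_append`. -/
def residual (C : Fin m → H →L[ℂ] H) (R₀ : H →L[ℂ] H) (w : List (Fin m)) : H →L[ℂ] H :=
  w.foldl (fun R j => residualUpdate (C j) R) R₀

lemma residual_append (C : Fin m → H →L[ℂ] H) (R₀ : H →L[ℂ] H) (w : List (Fin m)) (j : Fin m) :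
    residual C R₀ (w ++ [j]) = residualUpdate (C j) (residual C R₀ w) := by
  simp [residual]

/-- The dissipated piece `D_{w,j} = R_w^{1/2} C_j* C_j R_w^{1/2}`. -/
def dissipated (C : Fin m → H →L[ℂ] H) (R₀ : H →L[ℂ] H) (w : List (Fin m)) (j : Fin m) :
    H →L[ℂ] H :=
  CFC.sqrt (residual C R₀ w) * (star (C j) * C j) * CFC.sqrt (residual C R₀ w)

lemma star_mul_self_le_one {C : H →L[ℂ] H} (hC : ‖C‖ ≤ 1) : star C * C ≤ 1 := by
  rw [← CStarAlgebra.norm_le_one_iff_of_nonneg _ (star_mul_self_nonneg C),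
    CStarRing.norm_star_mul_self]
  exact mul_le_one₀ hC (norm_nonneg _) hC

lemma residualUpdate_nonneg {C R : H →L[ℂ] H} (hC : ‖C‖ ≤ 1) : 0 ≤ residualUpdate C R :=
  conjugate_nonneg_of_nonneg (sub_nonneg.2 (star_mul_self_le_one hC)) (CFC.sqrt_nonneg R)

lemma residualUpdate_le {C R : H →L[ℂ] H} (hR : 0 ≤ R) : residualUpdate C R ≤ R := by
  have h := conjugate_le_conjugate_of_nonneg (sub_le_self (1 : H →L[ℂ] H)
    (star_mul_self_nonneg C)) (CFC.sqrt_nonneg R)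
  rwa [mul_one, CFC.sqrt_mul_sqrt_self R] at h

lemma residual_nonneg {C : Fin m → H →L[ℂ] H} (hC : ∀ j, ‖C j‖ ≤ 1) {R₀ : H →L[ℂ] H}
    (h₀ : 0 ≤ R₀) (w : List (Fin m)) : 0 ≤ residual C R₀ w := by
  induction w using List.reverseRecOn with
  | nil => exact h₀
  | append_singleton w j _ => rw [residual_append]; exact residualUpdate_nonneg (hC j)

lemma residual_append_le {C : Fin m → H →L[ℂ] H} (hC : ∀ j, ‖C j‖ ≤ 1) {R₀ : H →L[ℂ] H}
    (h₀ : 0 ≤ R₀) (w : List (Fin m)) (j : Fin m) :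
    residual C R₀ (w ++ [j]) ≤ residual C R₀ w := by
  rw [residual_append]; exact residualUpdate_le (residual_nonneg hC h₀ w)

lemma residual_le {C : Fin m → H →L[ℂ] H} (hC : ∀ j, ‖C j‖ ≤ 1) {R₀ : H →L[ℂ] H}
    (h₀ : 0 ≤ R₀) (w : List (Fin m)) : residual C R₀ w ≤ R₀ := by
  induction w using List.reverseRecOn with
  | nil => exact le_rfl
  | append_singleton w j ih => exact (residual_append_le hC h₀ w j).trans ih

lemma dissipated_add_residual {C : Fin m → H →L[ℂ] H} (hC : ∀ j, ‖C j‖ ≤ 1) {R₀ : H →L[ℂ] H}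
    (h₀ : 0 ≤ R₀) (w : List (Fin m)) (j : Fin m) :
    dissipated C R₀ w j + residual C R₀ (w ++ [j]) = residual C R₀ w := by
  rw [residual_append, dissipated, residualUpdate, ← add_mul, ← mul_add, add_sub_cancel, mul_one,
    CFC.sqrt_mul_sqrt_self _ (residual_nonneg hC h₀ w)]

/-- For a word over the alphabet `{0, 1, …, m}`, its maximal prefix containing no `0`, read as a word
over `{1, …, m}`; the letter `j + 1` of `Fin (m + 1)` corresponds to the element `j` of `Fin m`. -/
def liveWord : List (Fin (m + 1)) → List (Fin m)
  | [] => []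
  | a :: u => if h : a = 0 then [] else a.pred h :: liveWord u

lemma liveWord_append (u : List (Fin (m + 1))) (a : Fin (m + 1)) :
    liveWord (u ++ [a]) = liveWord u ∨ ∃ j, liveWord (u ++ [a]) = liveWord u ++ [j] := by
  induction u with
  | nil =>
    by_cases h : a = 0
    · simp [liveWord, h]
    · simp [liveWord, h]
  | cons b u ih =>
    by_cases h : b = 0
    · simp [liveWord, h]
    · rcases ih with ih | ⟨j, ih⟩
      · left; simp [liveWord, h, ih]
      · right; exact ⟨j, by simp [liveWord, h, ih]⟩

/-- The word `ω|n` of the first `n` letters of the path `ω = (ω 0, ω 1, …)`. -/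
def initialWord {A : Type*} (ω : ℕ → A) (n : ℕ) : List A := List.ofFn fun i : Fin n => ω i

lemma initialWord_succ {A : Type*} (ω : ℕ → A) (n : ℕ) :
    initialWord ω (n + 1) = initialWord ω n ++ [ω n] := by
  rw [initialWord, List.ofFn_succ_last]; rfl

/-- The residual process `R_n(ω) = R_{ω|n}`, frozen at the first occurrence of `0`. -/
def pathResidual (C : Fin m → H →L[ℂ] H) (R₀ : H →L[ℂ] H) (ω : ℕ → Fin (m + 1)) (n : ℕ) :
    H →L[ℂ] H :=
  residual C R₀ (liveWord (initialWord ω n))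

lemma pathResidual_antitone {C : Fin m → H →L[ℂ] H} (hC : ∀ j, ‖C j‖ ≤ 1) {R₀ : H →L[ℂ] H}
    (h₀ : 0 ≤ R₀) (ω : ℕ → Fin (m + 1)) : Antitone (pathResidual C R₀ ω) := by
  refine antitone_nat_of_succ_le fun n => ?_
  rw [pathResidual, pathResidual, initialWord_succ]
  rcases liveWord_append (initialWord ω n) (ω n) with h | ⟨j, h⟩
  · rw [h]
  · rw [h]; exact residual_append_le hC h₀ _ j

lemma exists_boundaryVariable {C : Fin m → H →L[ℂ] H} (hC : ∀ j, ‖C j‖ ≤ 1)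
    (R₀ : PosTraceClass H) (ω : ℕ → Fin (m + 1)) :
    ∃ T : PosTraceClass H,
      ∀ x, Tendsto (fun n => pathResidual C R₀.op ω n x) atTop (𝓝 (T.op x)) := by
  obtain ⟨L, hL, h0, hle⟩ := exists_strong_limit (pathResidual C R₀.op ω)
    (fun n => residual_nonneg hC R₀.nonneg _) (pathResidual_antitone hC R₀.nonneg ω)
  exact ⟨⟨L, h0, R₀.traceClass.of_le h0 hle⟩, hL⟩

/-- The boundary variable `R_∞(ω)`, the strong limit of `R_n(ω)`, as an element of `S₁(H)₊`; it is
characterised by `tendsto_boundaryVariable`. -/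
def boundaryVariable (C : Fin m → H →L[ℂ] H) (hC : ∀ j, ‖C j‖ ≤ 1) (R₀ : PosTraceClass H)
    (ω : ℕ → Fin (m + 1)) : PosTraceClass H :=
  (exists_boundaryVariable hC R₀ ω).choose

lemma tendsto_boundaryVariable (C : Fin m → H →L[ℂ] H) (hC : ∀ j, ‖C j‖ ≤ 1)
    (R₀ : PosTraceClass H) (ω : ℕ → Fin (m + 1)) (x : H) :
    Tendsto (fun n => pathResidual C R₀.op ω n x) atTop
      (𝓝 ((boundaryVariable C hC R₀ ω).op x)) :=
  (exists_boundaryVariable hC R₀ ω).choose_spec x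

/-- The trace edge-energy `tr D_{w,j}`. -/
def edgeTrace (C : Fin m → H →L[ℂ] H) (R₀ : H →L[ℂ] H) (w : List (Fin m)) (j : Fin m) : ℝ≥0∞ :=
  posTrace (dissipated C R₀ w j)

/-- `s_w = ∑_j tr D_{w,j}`. -/
def nodeTrace (C : Fin m → H →L[ℂ] H) (R₀ : H →L[ℂ] H) (w : List (Fin m)) : ℝ≥0∞ :=
  ∑ j, edgeTrace C R₀ w j

open Classical in
/-- The trace-biased transition probabilities `p_{u,a}`: if `u` contains `0`, or `u` is a dead node,
all mass is on `a = 0`; otherwise `p_{u,0} = 0` and `p_{u,j} = tr D_{u,j} / s_u`. -/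
def transitionProb (C : Fin m → H →L[ℂ] H) (R₀ : H →L[ℂ] H) (u : List (Fin (m + 1))) :
    Fin (m + 1) → ℝ≥0∞ :=
  if 0 ∈ u ∨ nodeTrace C R₀ (liveWord u) = 0 then Pi.single 0 1
  else Fin.cons 0 fun j => edgeTrace C R₀ (liveWord u) j / nodeTrace C R₀ (liveWord u)

lemma nodeTrace_ne_top {C : Fin m → H →L[ℂ] H} (hC : ∀ j, ‖C j‖ ≤ 1) (R₀ : PosTraceClass H)
    (w : List (Fin m)) : nodeTrace C R₀.op w ≠ ∞ := by
  refine ENNReal.sum_ne_top.2 fun j _ => ?_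
  refine ne_top_of_le_ne_top (R₀.traceClass.posTrace_ne_top R₀.nonneg) (posTrace_mono ?_)
  refine le_trans ?_ (residual_le hC R₀.nonneg w)
  rw [← dissipated_add_residual hC R₀.nonneg w j]
  exact le_add_of_nonneg_right (residual_nonneg hC R₀.nonneg _)

lemma sum_transitionProb {C : Fin m → H →L[ℂ] H} (hC : ∀ j, ‖C j‖ ≤ 1) (R₀ : PosTraceClass H)
    (u : List (Fin (m + 1))) : ∑ a, transitionProb C R₀.op u a = 1 := by
  unfold transitionProb
  split_ifs with h
  · simp
  · rw [Fin.sum_univ_succ]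
    simp only [Fin.cons_zero, Fin.cons_succ, zero_add, div_eq_mul_inv, ← Finset.sum_mul]
    exact ENNReal.mul_inv_cancel (not_or.1 h).2 (nodeTrace_ne_top hC R₀ _)

/-- `transitionProb` as a probability mass function on `{0, 1, …, m}`. -/
def transition (C : Fin m → H →L[ℂ] H) (hC : ∀ j, ‖C j‖ ≤ 1) (R₀ : PosTraceClass H)
    (u : List (Fin (m + 1))) : PMF (Fin (m + 1)) :=
  PMF.ofFintype (transitionProb C R₀.op u) (sum_transitionProb hC R₀ u)

end Tree

section PathMeasure

variable {A : Type*} [Fintype A] [MeasurableSpace A] [DiscreteMeasurableSpace A]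

/-- The law of the letter `n + 1` given the first letters `0, …, n`. -/
def stepKernel (p : List A → PMF A) (n : ℕ) : Kernel (Π _ : Finset.Iic n, A) A :=
  Kernel.ofFunOfCountable fun v =>
    (p (List.ofFn fun i : Fin (n + 1) => v ⟨i, Finset.mem_Iic.2 (Nat.lt_succ_iff.1 i.2)⟩)).toMeasure

instance (p : List A → PMF A) (n : ℕ) : IsMarkovKernel (stepKernel p n) :=
  ⟨fun _ => PMF.toMeasure.isProbabilityMeasure _⟩

/-- The path measure on `A^ℕ` with transition probabilities `p`. Its cylinder weights satisfy
`ν[∅] = 1` and `ν[ua] = ν[u] p_u(a)`, see `pathMeasure_cylinder_nil` and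
`pathMeasure_cylinder_append`. -/
def pathMeasure (p : List A → PMF A) : Measure (ℕ → A) :=
  Kernel.trajMeasure (X := fun _ => A) (p []).toMeasure (stepKernel p)

instance (p : List A → PMF A) : IsProbabilityMeasure (pathMeasure p) := by
  have := PMF.toMeasure.isProbabilityMeasure (p [])
  unfold pathMeasure; infer_instance

/-- The cylinder set `[u]`. -/
def cylinder (u : List A) : Set (ℕ → A) := {ω | initialWord ω u.length = u}

lemma pathMeasure_cylinder_nil (p : List A → PMF A) : pathMeasure p (cylinder []) = 1 := by
  have : cylinder ([] : List A) = Set.univ := by ext; simp [cylinder, initialWord]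
  rw [this, measure_univ]

lemma pathMeasure_cylinder_append (p : List A → PMF A) (u : List A) (a : A) :
    pathMeasure p (cylinder (u ++ [a])) = pathMeasure p (cylinder u) * p u a := by
  have hp := PMF.toMeasure.isProbabilityMeasure (p [])
  have hcyl : cylinder (u ++ [a]) = {ω | initialWord ω u.length = u ∧ ω u.length = a} := by
    ext ω
    simp [cylinder, initialWord_succ]
  rcases hn : u.length with _ | n
  · obtain rfl := List.length_eq_zero_iff.1 hn
    rw [pathMeasure_cylinder_nil, one_mul, hcyl]
    have h0 : (pathMeasure p).map (fun ω => ω 0) = (p []).toMeasure := by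
      have e : (fun ω : ℕ → A => ω 0) =
          (MeasurableEquiv.piUnique fun _ : Finset.Iic 0 => A) ∘
            Preorder.frestrictLe (π := fun _ => A) 0 := rfl
      rw [e, ← Measure.map_map (MeasurableEquiv.measurable _) (by fun_prop), pathMeasure,
        Kernel.trajMeasure, Measure.map_comp _ _ (by fun_prop), Kernel.traj_map_frestrictLe,
        Kernel.partialTraj_self, Measure.id_comp, Measure.map_map (MeasurableEquiv.measurable _)
          (MeasurableEquiv.measurable _), MeasurableEquiv.self_comp_symm, Measure.map_id]
    have h1 := congrArg (fun μ => μ {a}) h0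
    simp only [PMF.toMeasure_apply_singleton _ _ (measurableSet_singleton a)] at h1
    rw [Measure.map_apply (measurable_pi_apply 0) (measurableSet_singleton a)] at h1
    rw [← h1]
    congr 1
    ext ω
    simp [initialWord]
  · let v : Π _ : Finset.Iic n, A := fun i => u[(i : ℕ)]'(by
      have := Finset.mem_Iic.1 i.2; omega)
    have hv : ∀ ω : ℕ → A, Preorder.frestrictLe (π := fun _ => A) n ω = v ↔
        initialWord ω u.length = u := by
      intro ω
      constructor
      · intro h
        refine List.ext_getElem (by rw [initialWord, List.length_ofFn]) fun i h1 h2 => ?_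
        refine (List.getElem_ofFn _).trans ?_
        exact congrFun h ⟨i, Finset.mem_Iic.2 (by omega)⟩
      · intro h
        funext i
        have hi : (i : ℕ) < u.length := by
          have := Finset.mem_Iic.1 i.2; omega
        have h3 : (initialWord ω u.length)[(i : ℕ)]'(by simpa [initialWord] using hi) = u[(i : ℕ)] := by
          simp only [h]
        exact (List.getElem_ofFn _).symm.trans h3
    have hvu : (List.ofFn fun i : Fin (n + 1) =>
        v ⟨i, Finset.mem_Iic.2 (Nat.lt_succ_iff.1 i.2)⟩) = u := by
      refine List.ext_getElem (by rw [List.length_ofFn, hn]) fun i h1 h2 => ?_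
      rw [List.getElem_ofFn]
    have key := Kernel.map_frestrictLe_trajMeasure_compProd_eq_map_trajMeasure
      (X := fun _ => A) (μ₀ := (p []).toMeasure) (κ := stepKernel p) (a := n)
    have h1 := congrArg (fun μ => μ ({v} ×ˢ {a})) key
    beta_reduce at h1
    rw [Measure.compProd_apply_prod (measurableSet_singleton _) (measurableSet_singleton _),
      Measure.map_apply (by fun_prop) ((measurableSet_singleton _).prod (measurableSet_singleton _)),
      Measure.restrict_singleton, lintegral_smul_measure, lintegral_dirac,
      Measure.map_apply (by fun_prop) (measurableSet_singleton _)] at h1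
    have h2 : stepKernel p n v {a} = p u a := by
      change (p _).toMeasure {a} = _
      rw [PMF.toMeasure_apply_singleton _ _ (measurableSet_singleton a), hvu]
    rw [h2, smul_eq_mul] at h1
    have e1 : Preorder.frestrictLe (π := fun _ => A) n ⁻¹' {v} = cylinder u := by
      ext ω; exact hv ω
    have e2 : (fun x : ℕ → A => (Preorder.frestrictLe (π := fun _ => A) n x, x (n + 1))) ⁻¹'
        ({v} ×ˢ {a}) = cylinder (u ++ [a]) := by
      ext ω
      rw [hcyl, hn]
      simp [hv, ← hn]
    rw [e1, e2] at h1
    exact h1.symm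

end PathMeasure

section Boundary

variable {H : Type*} [NormedAddCommGroup H] [InnerProductSpace ℂ H] [CompleteSpace H] {m : ℕ}

/-- The trace-biased path measure `ν_tr` on `Ω = {0, 1, …, m}^ℕ`. -/
def traceMeasure (C : Fin m → H →L[ℂ] H) (hC : ∀ j, ‖C j‖ ≤ 1) (R₀ : PosTraceClass H) :
    Measure (ℕ → Fin (m + 1)) :=
  pathMeasure (transition C hC R₀)

/-- The boundary law `μ_tr`, the image of `ν_tr` under `R_∞`. -/
def boundaryLaw (C : Fin m → H →L[ℂ] H) (hC : ∀ j, ‖C j‖ ≤ 1) (R₀ : PosTraceClass H) :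
    Measure (PosTraceClass H) :=
  (traceMeasure C hC R₀).map (boundaryVariable C hC R₀)

end Boundary

end

end WRTree

/-!
The proof rests on two facts about the boundary variable `R_∞`; the rest is disintegration of
measures on the standard Borel space `Ω`.

The residuals `R_n(ω)` decrease to `R_∞(ω)` strongly, and they are dominated by the trace-class
operator `R₀`. Dominated convergence for the series of diagonal entries upgrades this to convergence
in trace norm (`tendsto_posTrace_sub`, `tendsto_residualPoint`). Each `R_n` depends on finitely many
letters, so `R_∞` is a pointwise limit of finitely valued measurable maps and is Borel measurable
(`measurable_boundaryVariable`).

The kernel is the conditional distribution of the path given `R_∞`, which exists because `Ω` is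
standard Borel; nothing is needed of `S₁(H)₊`, which is not separable when `H` is not. Its
integral formulas are those of `condDistrib`. That it is carried by the fibres of `R_∞` follows
because the joint law of `(R_∞(ω), ω)` is carried by the graph of `R_∞`, once that graph is known to
be measurable in the product (`measurableSet_graph_boundaryVariable`).
-/

namespace WRTree

section TraceConvergence

variable {H : Type*} [NormedAddCommGroup H] [InnerProductSpace ℂ H] [CompleteSpace H]

lemma strong_limit_nonneg_le {A : ℕ → H →L[ℂ] H} {L : H →L[ℂ] H} (h0 : ∀ n, 0 ≤ A n)
    (hA : Antitone A) (hL : ∀ x, Tendsto (fun n => A n x) atTop (𝓝 (L x))) (n : ℕ) :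
    0 ≤ L ∧ L ≤ A n := by
  obtain ⟨M, hM, hM0, hMn⟩ := exists_strong_limit (fun k => A (k + n)) (fun k => h0 _)
    fun i j hij => hA (by omega)
  have : M = L := by
    ext x
    exact tendsto_nhds_unique (hM x) ((hL x).comp (tendsto_add_atTop_nat n))
  subst this
  exact ⟨hM0, by simpa using hMn⟩

/-- A decreasing sequence of positive operators of finite trace converges to its strong limit in
trace norm: on the diagonal, the trace of the first operator dominates. -/
lemma tendsto_posTrace_sub {A : ℕ → H →L[ℂ] H} {L : H →L[ℂ] H} (h0 : ∀ n, 0 ≤ A n)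
    (hA : Antitone A) (hL : ∀ x, Tendsto (fun n => A n x) atTop (𝓝 (L x)))
    (hfin : posTrace (A 0) ≠ ∞) :
    Tendsto (fun n => posTrace (A n - L)) atTop (𝓝 0) := by
  set e := basis H
  have hlim := strong_limit_nonneg_le h0 hA hL
  have hpos : ∀ {P : H →L[ℂ] H}, 0 ≤ P → ∀ x, 0 ≤ (inner ℂ x (P x)).re := fun hP x =>
    ((ContinuousLinearMap.nonneg_iff_isPositive _).1 hP).re_inner_nonneg_right x
  have hd : ∀ n, 0 ≤ A n - L := fun n => sub_nonneg.2 (hlim n).2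
  have hle : ∀ n i, (inner ℂ (e i) ((A n - L) (e i))).re ≤ (inner ℂ (e i) (A 0 (e i))).re := by
    intro n i
    have hn : A n - L ≤ A 0 := (sub_le_self _ (hlim 0).1).trans (hA n.zero_le)
    have := hpos (sub_nonneg.2 hn) (e i)
    rw [sub_apply, inner_sub_right, Complex.sub_re] at this
    linarith
  have hs : Summable fun i => (inner ℂ (e i) (A 0 (e i))).re :=
    (ENNReal.summable_toReal hfin).congr fun i => ENNReal.toReal_ofReal (hpos (h0 0) _)
  have hterm : ∀ i, Tendsto (fun n => (inner ℂ (e i) ((A n - L) (e i))).re) atTop (𝓝 0) := by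
    intro i
    have h1 : Tendsto (fun n => (A n - L) (e i)) atTop (𝓝 0) := by
      simpa using (hL (e i)).sub_const (L (e i))
    have h2 : Tendsto (fun n => inner ℂ (e i) ((A n - L) (e i))) atTop (𝓝 (inner ℂ (e i) 0)) :=
      tendsto_const_nhds.inner h1
    simpa only [inner_zero_right, Complex.zero_re] using!
      (Complex.continuous_re.tendsto _).comp h2
  have key := tendsto_tsum_of_dominated_convergence hs hterm
    (Eventually.of_forall fun n i => by
      rw [Real.norm_of_nonneg (hpos (hd n) _)]; exact hle n i)
  have hT : ∀ n, posTrace (A n - L)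
      = ENNReal.ofReal (∑' i, (inner ℂ (e i) ((A n - L) (e i))).re) := fun n =>
    (ENNReal.ofReal_tsum_of_nonneg (fun i => hpos (hd n) _)
      (hs.of_nonneg_of_le (fun i => hpos (hd n) _) (hle n))).symm
  simp_rw [hT]
  simpa using ENNReal.tendsto_ofReal key

end TraceConvergence

section BoundaryMeasurability

variable {H : Type*} [NormedAddCommGroup H] [InnerProductSpace ℂ H] [CompleteSpace H] {m : ℕ}

/-- The residual `R_w` as a point of `S₁(H)₊`. -/
noncomputable def residualPoint (C : Fin m → H →L[ℂ] H) (hC : ∀ j, ‖C j‖ ≤ 1) (R₀ : PosTraceClass H)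
    (w : List (Fin m)) : PosTraceClass H where
  op := residual C R₀.op w
  nonneg := residual_nonneg hC R₀.nonneg w
  traceClass := R₀.traceClass.of_le (residual_nonneg hC R₀.nonneg w) (residual_le hC R₀.nonneg w)

/-- The residual process converges to the boundary variable in trace norm, not only strongly. -/
lemma tendsto_residualPoint (C : Fin m → H →L[ℂ] H) (hC : ∀ j, ‖C j‖ ≤ 1) (R₀ : PosTraceClass H)
    (ω : ℕ → Fin (m + 1)) :
    Tendsto (fun n => residualPoint C hC R₀ (liveWord (initialWord ω n))) atTop
      (𝓝 (boundaryVariable C hC R₀ ω)) := by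
  rw [tendsto_iff_dist_tendsto_zero]
  have h0 : ∀ n, 0 ≤ pathResidual C R₀.op ω n := fun n => residual_nonneg hC R₀.nonneg _
  have hanti := pathResidual_antitone hC R₀.nonneg ω
  have hL := tendsto_boundaryVariable C hC R₀ ω
  have h := tendsto_posTrace_sub h0 hanti hL (R₀.traceClass.posTrace_ne_top R₀.nonneg)
  have h2 := (ENNReal.tendsto_toReal ENNReal.zero_ne_top).comp h
  rw [ENNReal.toReal_zero] at h2
  refine h2.congr fun n => ?_
  have hd := sub_nonneg.2 (strong_limit_nonneg_le h0 hanti hL n).2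
  exact congrArg ENNReal.toReal (traceNorm_of_nonneg hd).symm

lemma measurable_finRestrict (n : ℕ) :
    Measurable fun (ω : ℕ → Fin (m + 1)) (i : Fin n) => ω i := by
  fun_prop

lemma measurable_boundaryVariable (C : Fin m → H →L[ℂ] H) (hC : ∀ j, ‖C j‖ ≤ 1)
    (R₀ : PosTraceClass H) : Measurable (boundaryVariable C hC R₀) := by
  refine measurable_of_tendsto_metrizable (fun n => ?_)
    (tendsto_pi_nhds.2 (tendsto_residualPoint C hC R₀))
  exact (measurable_of_finite fun v : Fin n → Fin (m + 1) =>
    residualPoint C hC R₀ (liveWord (List.ofFn v))).comp (measurable_finRestrict n)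

/-- A limit of measurable maps with finitely many values has a measurable graph, even if the target
is not separable, when its diagonal may fail to be measurable: the distance from `x` to the limit at
`ω` is the limit of the distances from `x` to finitely many points, hence jointly measurable. -/
lemma measurableSet_graph_of_tendsto {X Ω : Type*} [MetricSpace X] [MeasurableSpace X]
    [OpensMeasurableSpace X] [MeasurableSpace Ω] {F : ℕ → Type*} [∀ n, Finite (F n)]
    [∀ n, MeasurableSpace (F n)] [∀ n, MeasurableSingletonClass (F n)] {π : ∀ n, Ω → F n}
    (hπ : ∀ n, Measurable (π n)) (g : ∀ n, F n → X) {Y : Ω → X}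
    (hY : ∀ ω, Tendsto (fun n => g n (π n ω)) atTop (𝓝 (Y ω))) :
    MeasurableSet {p : X × Ω | Y p.2 = p.1} := by
  have hfin (n : ℕ) : Measurable fun q : X × F n => dist (g n q.2) q.1 :=
    measurable_from_prod_countable_left fun v =>
      (continuous_const.dist continuous_id : Continuous fun x => dist (g n v) x).measurable
  have hdist : Measurable fun p : X × Ω => dist (Y p.2) p.1 :=
    measurable_of_tendsto_metrizable
      (fun n => (hfin n).comp (measurable_fst.prodMk ((hπ n).comp measurable_snd)))
      (tendsto_pi_nhds.2 fun p => (hY p.2).dist tendsto_const_nhds)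
  simpa only [Set.preimage, Set.mem_singleton_iff, dist_eq_zero] using
    hdist (measurableSet_singleton 0)

lemma measurableSet_graph_boundaryVariable (C : Fin m → H →L[ℂ] H) (hC : ∀ j, ‖C j‖ ≤ 1)
    (R₀ : PosTraceClass H) :
    MeasurableSet {p : PosTraceClass H × (ℕ → Fin (m + 1)) |
      boundaryVariable C hC R₀ p.2 = p.1} :=
  measurableSet_graph_of_tendsto measurable_finRestrict
    (fun _ v => residualPoint C hC R₀ (liveWord (List.ofFn v)))
    (tendsto_residualPoint C hC R₀)

instance (C : Fin m → H →L[ℂ] H) (hC : ∀ j, ‖C j‖ ≤ 1) (R₀ : PosTraceClass H) :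
    IsProbabilityMeasure (traceMeasure C hC R₀) :=
  inferInstanceAs (IsProbabilityMeasure (pathMeasure _))

end BoundaryMeasurability

end WRTree

theorem theorem7p2 {H : Type*} [NormedAddCommGroup H] [InnerProductSpace ℂ H] [CompleteSpace H]
    {m : ℕ} (hm : 1 ≤ m) (C : Fin m → H →L[ℂ] H) (hC : ∀ j, ‖C j‖ ≤ 1)
    (R₀ : WRTree.PosTraceClass H) :
    Measurable (WRTree.boundaryVariable C hC R₀) ∧
    ∃ κ : Kernel (WRTree.PosTraceClass H) (ℕ → Fin (m + 1)),
      IsMarkovKernel κ ∧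
      (∀ E : Set (ℕ → Fin (m + 1)), MeasurableSet E →
        Measurable (fun T => κ T E) ∧
        WRTree.traceMeasure C hC R₀ E = ∫⁻ T, κ T E ∂(WRTree.boundaryLaw C hC R₀)) ∧
      (∀ᵐ T ∂(WRTree.boundaryLaw C hC R₀),
        κ T {ω | WRTree.boundaryVariable C hC R₀ ω = T} = 1) ∧
      (∀ (𝕜 : Type) [RCLike 𝕜] (f : (ℕ → Fin (m + 1)) → 𝕜),
        Integrable f (WRTree.traceMeasure C hC R₀) →
          (∀ᵐ ω ∂(WRTree.traceMeasure C hC R₀),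
            Integrable f (κ (WRTree.boundaryVariable C hC R₀ ω))) ∧
          (WRTree.traceMeasure C hC R₀)[f |
              MeasurableSpace.comap (WRTree.boundaryVariable C hC R₀) inferInstance]
            =ᵐ[WRTree.traceMeasure C hC R₀]
              fun ω => ∫ η, f η ∂(κ (WRTree.boundaryVariable C hC R₀ ω))) := by
  have hR := WRTree.measurable_boundaryVariable C hC R₀
  have hG := WRTree.measurableSet_graph_boundaryVariable C hC R₀
  set ν := WRTree.traceMeasure C hC R₀
  set R := WRTree.boundaryVariable C hC R₀
  have hjoint : ν.map R ⊗ₘ condDistrib id R ν = ν.map fun ω => (R ω, ω) :=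
    compProd_map_condDistrib measurable_id.aemeasurable
  refine ⟨hR, condDistrib id R ν, inferInstance, fun E hE => ⟨Kernel.measurable_coe _ hE, ?_⟩,
    ?_, fun 𝕜 _ f hf => ⟨?_, condExp_ae_eq_integral_condDistrib_id hR hf⟩⟩
  · have h := congrArg (fun ρ => ρ (Set.univ ×ˢ E)) hjoint
    beta_reduce at h
    rw [Measure.compProd_apply_prod MeasurableSet.univ hE, Measure.restrict_univ,
      Measure.map_apply (by fun_prop) (MeasurableSet.univ.prod hE)] at h
    rw [Set.univ_prod] at h
    exact h.symm
  · change ∀ᵐ T ∂(ν.map R), condDistrib id R ν T {ω | R ω = T} = 1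
    have hae : ∀ᵐ p ∂(ν.map R ⊗ₘ condDistrib id R ν), R p.2 = p.1 := by
      rw [hjoint, ae_map_iff (by fun_prop) hG]
      exact ae_of_all _ fun _ => rfl
    filter_upwards [Measure.ae_ae_of_ae_compProd hae] with T hT
    exact (measure_congr (eventuallyEq_univ.2 hT)).trans measure_univ
  · have hf' : Integrable (fun p : WRTree.PosTraceClass H × (ℕ → Fin (m + 1)) => f p.2)
        (ν.map fun ω => (R ω, ω)) := by
      exact hf.comp_snd_map_prodMk R
    exact hf'.condDistrib_ae hR.aemeasurable measurable_id.aemeasurable
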